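/- Let $p\ge 3$ be a prime and let $$H_p=\left\{\begin{pmatrix}1&a&c\\0&1&b\\0&0&1\end{pmatrix} : a,b,c\in\mathbb Z/p\mathbb Z\right\}$$ be the Heisenberg group over $\mathbb Z/p\mathbb Z$, a group of order $p^3$ under matrix multiplication. For an element $F=\sum_{g\in H_p}a_g\,g$ of the group ring $\mathbb Z[H_p]$ let $$M_{H_p}(F)=\det\left(a_{gh^{-1}}\right)_{g,h\in H_p}\in\mathbb Z$$ be its integer group determinant. If $p\mid M_{H_p}(F)$, then $p^{p^2+3}\mid M_{H_p}(F)$. Moreover, there exists $F\in\mathbb Z[H_p]$ such that $p^{p^2+3}\parallel M_{H_p}(F)$, that is, $p^{p^2+3}\mid M_{H_p}(F)$ but $p^{p^2+4}\nmid M_{H_p}(F)$. -/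

import Mathlib

/-- The Heisenberg group over `R`: the group, under matrix multiplication, of all `3 × 3` matrices
`!![1, a, c; 0, 1, b; 0, 0, 1]` with `a, b, c ∈ R`. -/
def heisenbergGroup (R : Type*) [CommRing R] :
    Subgroup (Matrix.SpecialLinearGroup (Fin 3) R) where
  carrier := {g | ∃ a b c : R, (g : Matrix (Fin 3) (Fin 3) R) = !![1, a, c; 0, 1, b; 0, 0, 1]}
  one_mem' := ⟨0, 0, 0, by
    ext i j; fin_cases i <;> fin_cases j <;> simp⟩
  mul_mem' := by
    rintro g h ⟨a, b, c, hg⟩ ⟨a', b', c', hh⟩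
    refine ⟨a' + a, b' + b, c' + a * b' + c, ?_⟩
    rw [Matrix.SpecialLinearGroup.coe_mul, hg, hh]
    ext i j; fin_cases i <;> fin_cases j <;> simp [Matrix.mul_apply, Fin.sum_univ_three]
  inv_mem' := by
    rintro g ⟨a, b, c, hg⟩
    refine ⟨-a, -b, a * b - c, ?_⟩
    rw [Matrix.SpecialLinearGroup.coe_inv, hg, Matrix.adjugate_fin_three]
    ext i j; fin_cases i <;> fin_cases j <;> simp

noncomputable instance heisenbergGroup.instFintype (R : Type*) [CommRing R] [Finite R] :
    Fintype (heisenbergGroup R) :=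
  Fintype.ofFinite _

/-- The integer group determinant `M_G(F) = det (a_{g h⁻¹})`, rows indexed by `g` and columns
by `h`, of an element `F = ∑ a_g g` of the integral group ring `ℤ[G]` of a finite group `G`. -/
def groupDet {G : Type*} [Group G] [Fintype G] [DecidableEq G] (F : MonoidAlgebra ℤ G) : ℤ :=
  Matrix.det (Matrix.of fun g h : G => F.coeff (g * h⁻¹))

/-! Let ζ be a primitive `p`-th root of unity and π = ζ - 1; in ℤ[ζ], `p` is an associate of
π^(p-1). The group determinant is the product of the values of `F` at the p² linear characters and
of D_k^p, where D_k runs over the determinants of the p - 1 representations of degree p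
(`cast_groupDet`). Each linear factor is congruent modulo π to the sum ε of the coefficients, and
D_k ≡ ε even modulo `p` (`dvd_det_rep_sub_sum`). Hence p ∣ M(F) forces p ∣ ε.

Suppose p ∣ ε. The D_k^p contribute p^(p(p-1)) and the trivial character contributes p. The other p²
- 1 linear factors are divisible by π. To first order in π they are given by a linear form in the
character, which vanishes at p - 1 nontrivial characters at least; there π² divides. This yields
π^((p-1)(p+2)), that is p^(p+2), and the total exponent is p² + 3.

For sharpness take F = y - f(x) with f = 1 + (x-1)² + k(1 + x + ⋯ + x^(p-1)). The linear factors
multiply to ∏ (1 - f(ζ^s)^p), every D_k equals 1 - ∏ f(ζ^s), and `k` is chosen so that no factor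
exceeds the required power of `p`. -/

/-! ### Diagonalization of convolution matrices by characters -/

/-- The matrix of values of pairwise distinct characters of a finite abelian group is
nonsingular. -/
theorem det_addChar_matrix_ne_zero {V R : Type*} [AddCommGroup V] [Fintype V] [DecidableEq V]
    [CommRing R] [IsDomain R] (χ : V → AddChar V R) (hχ : Function.Injective χ) :
    (Matrix.of fun v u : V => χ u (-v)).det ≠ 0 := by
  intro h
  obtain ⟨c, hc, h0⟩ := Matrix.exists_mulVec_eq_zero_iff.mpr h
  have hli := (linearIndependent_monoidHom (Multiplicative V) R).comp
    (fun u => (χ u).toMonoidHom) fun a b hab => hχ <| DFunLike.ext _ _ fun v =>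
      DFunLike.congr_fun hab (Multiplicative.ofAdd v)
  rw [Fintype.linearIndependent_iff] at hli
  refine hc (funext fun u => hli c ?_ u)
  funext v
  have := congrFun h0 (-v.toAdd)
  simpa [Matrix.mulVec, dotProduct, mul_comm] using this

/-- A matrix whose blocks are convolution matrices on a finite abelian group is block
diagonalized by the characters of the group. -/
theorem det_block_convolution {V ι R : Type*} [AddCommGroup V] [Fintype V] [DecidableEq V]
    [Fintype ι] [DecidableEq ι] [CommRing R] [IsDomain R]
    (χ : V → AddChar V R) (hχ : Function.Injective χ) (f : ι → ι → V → R) :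
    (Matrix.of fun x y : ι × V => f x.1 y.1 (x.2 - y.2)).det =
      ∏ u, (Matrix.of fun i j => ∑ v, f i j v * χ u v).det := by
  set P : Matrix V V R := Matrix.of fun v u : V => χ u (-v) with hP
  set Q : Matrix (ι × V) (ι × V) R := Matrix.kroneckerMap (· * ·) 1 P with hQ
  have hQ0 : Q.det ≠ 0 := by
    rw [hQ, Matrix.det_kronecker]
    simpa using pow_ne_zero _ (det_addChar_matrix_ne_zero χ hχ)
  -- The columns of `Q` block diagonalize the matrix; cancelling `Q.det ≠ 0` avoids inverting `Q`,
  -- so a domain suffices.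
  have key : (Matrix.of fun x y : ι × V => f x.1 y.1 (x.2 - y.2)) * Q =
      Q * Matrix.blockDiagonal fun u => Matrix.of fun i j => ∑ v, f i j v * χ u v := by
    ext ⟨i, v⟩ ⟨j, u⟩
    simp only [Matrix.mul_apply, Fintype.sum_prod_type, hQ, Matrix.kroneckerMap_apply, hP,
      Matrix.of_apply, Matrix.blockDiagonal_apply, Matrix.one_apply]
    rw [Finset.sum_eq_single j (by intro b _ hb; simp [hb]) (by simp),
      Finset.sum_eq_single i (by intro b _ hb; simp [hb.symm]) (by simp)]
    simp only [if_true, one_mul, mul_ite, mul_zero, Finset.sum_ite_eq', Finset.mem_univ,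
      Finset.mul_sum]
    refine Fintype.sum_equiv (Equiv.subLeft v) _ _ fun w => ?_
    rw [mul_left_comm, ← AddChar.map_add_eq_mul, Equiv.subLeft_apply, neg_add_eq_sub,
      sub_sub_cancel_left]
  have h := congrArg Matrix.det key
  rw [Matrix.det_mul, Matrix.det_mul, mul_comm, Matrix.det_blockDiagonal] at h
  exact mul_left_cancel₀ hQ0 h

/-- The determinant of a circulant matrix as a product over characters. -/
theorem det_convolution {V R : Type*} [AddCommGroup V] [Fintype V] [DecidableEq V]
    [CommRing R] [IsDomain R] (χ : V → AddChar V R) (hχ : Function.Injective χ) (f : V → R) :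
    (Matrix.of fun x y : V => f (x - y)).det = ∏ u, ∑ v, f v * χ u v := by
  have h := det_block_convolution (ι := Unit) χ hχ fun _ _ => f
  simp only [Matrix.det_unique, Matrix.of_apply] at h
  rw [← h, ← Matrix.det_submatrix_equiv_self (Equiv.punitProd V)]
  rfl

/-! ### Twisted circulant determinants modulo `p` -/

/-- The sign of a translation of `ZMod p`, for `p` odd, is `1`. -/
theorem sign_addRight_zmod {p : ℕ} [NeZero p] (hp : Odd p) (b : ZMod p) :
    Equiv.Perm.sign (Equiv.addRight b) = 1 := by
  have h1 : (Equiv.addRight b : Equiv.Perm (ZMod p)) ^ p = 1 := by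
    ext x
    simp
  have h2 := congrArg Equiv.Perm.sign h1
  rw [map_pow, map_one] at h2
  rcases Int.units_eq_one_or (Equiv.Perm.sign (Equiv.addRight b : Equiv.Perm (ZMod p))) with h | h
  · exact h
  · rw [h, hp.neg_one_pow] at h2
    exact absurd h2 (by decide)

/-- It makes the phase ψ(a ∑ b) trivial in the Leibniz terms fixed by translation. -/
theorem sum_zmod_eq_zero {p : ℕ} [NeZero p] (hp : Odd p) : ∑ b : ZMod p, b = 0 := by
  have h : ∑ b : ZMod p, b = - ∑ b : ZMod p, b := by
    rw [← Finset.sum_neg_distrib]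
    exact (Equiv.sum_comp (Equiv.neg (ZMod p)) fun b => b).symm
  rcases (ZMod.neg_eq_self_iff _).mp h.symm with h | h
  · exact h
  · exact absurd hp (Nat.not_odd_iff_even.mpr ⟨_, by rw [← h, two_mul]⟩)

/-- The sum of an invariant function under an operation of order `p` is, in characteristic `p`,
its sum over the fixed points. -/
theorem sum_eq_sum_fixedPoints {X R : Type*} [Fintype X] [DecidableEq X] [CommRing R] {p : ℕ}
    [Fact p.Prime] (hp0 : (p : R) = 0) (τ : X → X) (hτ : τ^[p] = id) (w : X → R)
    (hw : ∀ x, w (τ x) = w x) :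
    ∑ x, w x = ∑ x with τ x = x, w x := by
  classical
  -- On a fibre of `w` the summand is constant, so it remains to compare cardinalities modulo `p`,
  -- where orbits have size 1 or `p`.
  rw [← Finset.sum_fiberwise_of_maps_to (t := Finset.univ.image w) (g := w)
      (fun x _ => Finset.mem_image_of_mem w (Finset.mem_univ x)),
    ← Finset.sum_fiberwise_of_maps_to (t := Finset.univ.image w) (g := w)
      (s := Finset.univ.filter fun x => τ x = x)
      (fun x _ => Finset.mem_image_of_mem w (Finset.mem_univ x))]
  refine Finset.sum_congr rfl fun v _ => ?_
  rw [Finset.sum_congr rfl (g := fun _ => v) (by simp +contextual),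
    Finset.sum_congr (s₁ := Finset.filter (fun x => w x = v) (Finset.filter (fun x => τ x = x) _))
      rfl (g := fun _ => v) (by simp +contextual)]
  rw [Finset.sum_const, Finset.sum_const, nsmul_eq_mul, nsmul_eq_mul]
  congr 1
  let g : Function.End {x // w x = v} := fun x => ⟨τ x.1, (hw _).trans x.2⟩
  have hg : g ^ p ^ 1 = 1 := by
    rw [pow_one]
    have hk : ∀ k : ℕ, ∀ x, ((g ^ k) x).1 = τ^[k] x.1 := by
      intro k
      induction k with
      | zero => intro x; rfl
      | succ k ih =>
        intro x
        rw [pow_succ]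
        exact ih (g x)
    funext x
    apply Subtype.ext
    rw [hk, hτ]
    rfl
  have h := Equiv.Perm.card_fixedPoints_modEq hg
  have hc : ∀ a b : ℕ, a ≡ b [MOD p] → (a : R) = b := by
    intro a b hab
    obtain ⟨c, hc⟩ := (Nat.modEq_iff_dvd.mp hab)
    have : ((b : ℤ) - a : R) = 0 := by exact_mod_cast (by rw [hc]; push_cast; simp [hp0] :
      (((b : ℤ) - a : ℤ) : R) = 0)
    push_cast at this
    exact (sub_eq_zero.mp this).symm
  have h' := hc _ _ h
  rw [Fintype.card_subtype] at h'
  rw [h']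
  congr 1
  rw [← Set.toFinset_card]
  refine Finset.card_bij (fun x _ => x.1) ?_ (fun a _ b _ h => Subtype.ext h) ?_
  · intro x hx
    have hx' : g x = x := (Set.mem_toFinset (s := Function.fixedPoints g)).mp hx
    simpa using ⟨congrArg Subtype.val hx', x.2⟩
  · intro x hx
    simp only [Finset.mem_filter, Finset.mem_univ, true_and] at hx
    refine ⟨⟨x, hx.2⟩, ?_, rfl⟩
    have hx' : g ⟨x, hx.2⟩ = ⟨x, hx.2⟩ := Subtype.ext hx.1
    exact Set.mem_toFinset.mpr hx'

/-- The action of the translation by `1` on pairs of a permutation of `ZMod p` and a self-map of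
`ZMod p`. -/
def translatePair (p : ℕ) :
    Equiv.Perm (Equiv.Perm (ZMod p) × (ZMod p → ZMod p)) :=
  Equiv.prodCongr (Equiv.permCongr (Equiv.addRight 1))
    (Equiv.arrowCongr (Equiv.addRight 1) (Equiv.refl _))

theorem translatePair_fst (p : ℕ) (x : Equiv.Perm (ZMod p) × (ZMod p → ZMod p)) (b : ZMod p) :
    (translatePair p x).1 b = x.1 (b - 1) + 1 := by
  simp [translatePair, sub_eq_add_neg]

theorem translatePair_snd (p : ℕ) (x : Equiv.Perm (ZMod p) × (ZMod p → ZMod p)) (b : ZMod p) :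
    (translatePair p x).2 b = x.2 (b - 1) := by
  simp [translatePair, sub_eq_add_neg]

theorem translatePair_iterate (p : ℕ) : (translatePair p)^[p] = id := by
  have h : ∀ k : ℕ, ∀ x, (∀ b, ((translatePair p)^[k] x).1 b = x.1 (b - k) + k) ∧
      ∀ b, ((translatePair p)^[k] x).2 b = x.2 (b - k) := by
    intro k
    induction k with
    | zero => simp
    | succ k ih =>
      intro x
      refine ⟨fun b => ?_, fun b => ?_⟩
      · rw [Function.iterate_succ_apply, (ih _).1, translatePair_fst]
        push_cast
        rw [sub_sub, add_right_comm, add_assoc]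
      · rw [Function.iterate_succ_apply, (ih _).2, translatePair_snd]
        push_cast
        rw [sub_sub]
  funext x
  refine Prod.ext (Equiv.ext fun b => ?_) (funext fun b => ?_)
  · simp [(h p x).1]
  · simp [(h p x).2]

theorem AddChar.map_finset_sum {ι A M : Type*} [AddCommMonoid A] [CommMonoid M] (ψ : AddChar A M)
    (s : Finset ι) (g : ι → A) : ψ (∑ i ∈ s, g i) = ∏ i ∈ s, ψ (g i) := by
  classical
  induction s using Finset.induction_on with
  | empty => simp
  | insert a s ha ih => rw [Finset.sum_insert ha, Finset.prod_insert ha, map_add_eq_mul, ih]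

/-- A twisted circulant determinant over `ZMod p` is congruent modulo `p` to the sum of the
`p`-th powers of its coefficients. -/
theorem dvd_det_twisted_sub_sum_pow {R : Type*} [CommRing R] [IsDomain R] {p : ℕ}
    [Fact p.Prime] (hp : Odd p) (ψ : AddChar (ZMod p) R) (hψ : ∀ s, s ≠ 0 → ψ s ≠ 1)
    (φ : ZMod p → ZMod p → R) :
    (p : R) ∣ (Matrix.of fun b b' : ZMod p => ∑ a, φ (b - b') a * ψ (a * b')).det -
      ∑ β, ∑ a, φ β a ^ p := by
  classical
  -- The Leibniz expansion with each entry expanded too: a term is a permutation together with a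
  -- choice of `a` in every column.
  let w : Equiv.Perm (ZMod p) × (ZMod p → ZMod p) → R := fun x =>
    ((Equiv.Perm.sign x.1 : ℤ) : R) * ∏ b, φ (x.1 b - b) (x.2 b) * ψ (x.2 b * b)
  let S : Equiv.Perm (ZMod p) × (ZMod p → ZMod p) → ZMod p := fun x => ∑ b, x.2 b
  have hdet : (Matrix.of fun b b' : ZMod p => ∑ a, φ (b - b') a * ψ (a * b')).det =
      ∑ x, w x := by
    rw [Matrix.det_apply', Fintype.sum_prod_type]
    refine Finset.sum_congr rfl fun σ _ => ?_
    simp only [Matrix.of_apply, w]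
    rw [Finset.prod_univ_sum, Finset.mul_sum, Fintype.piFinset_univ]
  have hS : ∀ x, S (translatePair p x) = S x := by
    intro x
    simp only [S, translatePair_snd]
    exact Equiv.sum_comp (Equiv.subRight (1 : ZMod p)) x.2
  have hw : ∀ x, w (translatePair p x) = w x * ψ (S x) := by
    intro x
    have hsign : Equiv.Perm.sign (translatePair p x).1 = Equiv.Perm.sign x.1 :=
      Equiv.Perm.sign_permCongr _ _
    simp only [w, hsign, translatePair_fst, translatePair_snd]
    rw [mul_assoc]
    congr 1
    rw [← Equiv.prod_comp (Equiv.addRight (1 : ZMod p))]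
    have : ψ (S x) = ∏ b, ψ (x.2 b) := AddChar.map_finset_sum ψ _ _
    rw [this, ← Finset.prod_mul_distrib]
    refine Finset.prod_congr rfl fun b _ => ?_
    simp only [Equiv.coe_addRight, add_sub_cancel_right, add_sub_add_right_eq_sub]
    rw [mul_add, mul_one, AddChar.map_add_eq_mul, mul_assoc]
  -- Translation permutes the terms with `S x = s` and multiplies each by `ψ s ≠ 1`, so their sum
  -- vanishes.
  have hzero : ∀ s, s ≠ 0 → ∑ x, (if S x = s then w x else 0) = 0 := by
    intro s hs
    have h : ∑ x, (if S x = s then w x else 0) = (∑ x, if S x = s then w x else 0) * ψ s := by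
      conv_lhs => rw [← Equiv.sum_comp (translatePair p)]
      rw [Finset.sum_mul]
      refine Finset.sum_congr rfl fun x _ => ?_
      rw [hS, hw]
      split_ifs with h
      · rw [h]
      · simp
    by_contra h0
    exact hψ s hs (mul_left_cancel₀ h0 (by rw [← h, mul_one]))
  have hsum : ∑ x, w x = ∑ x, if S x = 0 then w x else 0 := by
    have h : ∀ x, w x = ∑ s, if S x = s then w x else 0 := by simp
    rw [Finset.sum_congr rfl fun x _ => h x, Finset.sum_comm]
    exact Fintype.sum_eq_single 0 hzero
  rw [← Ideal.mem_span_singleton, ← Ideal.Quotient.eq, hdet, hsum]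
  set q := Ideal.Quotient.mk (Ideal.span {(p : R)}) with hq
  have hp0 : ((p : ℕ) : R ⧸ Ideal.span {(p : R)}) = 0 := by
    rw [← map_natCast q, hq, Ideal.Quotient.eq_zero_iff_mem]
    exact Ideal.mem_span_singleton_self _
  rw [map_sum, sum_eq_sum_fixedPoints hp0 (translatePair p) (translatePair_iterate p)
    (fun x => q (if S x = 0 then w x else 0))
    (by
      intro x
      rw [hS, hw]
      split_ifs with h
      · simp [h]
      · rfl)]
  rw [← Fintype.sum_prod_type', map_sum]
  -- A pair fixed by translation is a translation of `ZMod p` with a constant choice of `a`; its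
  -- term is φ(β, a)^p.
  refine Finset.sum_bij' (fun x _ => (x.1 0, x.2 0))
    (fun y _ => (Equiv.addRight y.1, fun _ => y.2)) (by simp) ?_ ?_ (by simp) ?_
  · intro y _
    simp only [Finset.mem_filter, Finset.mem_univ, true_and]
    refine Prod.ext (Equiv.ext fun b => ?_) (funext fun b => ?_)
    · rw [translatePair_fst]
      simp only [Equiv.coe_addRight]
      ring
    · rw [translatePair_snd]
  all_goals
    intro x hx
    have hx' : translatePair p x = x := (Finset.mem_filter.mp hx).2
    have h1 : ∀ b, x.1 (b - 1) + 1 = x.1 b := fun b => by rw [← translatePair_fst, hx']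
    have h2 : ∀ b, x.2 (b - 1) = x.2 b := fun b => by rw [← translatePair_snd, hx']
    have h3 : ∀ k : ℕ, x.1 k = k + x.1 0 ∧ x.2 k = x.2 0 := by
      intro k
      induction k with
      | zero => simp
      | succ k ih =>
        rw [← h1, ← h2]
        push_cast
        rw [add_sub_cancel_right, ih.1, ih.2]
        exact ⟨by ring, rfl⟩
    have h4 : ∀ b, x.1 b = b + x.1 0 := fun b => by
      have := (h3 b.val).1
      rwa [ZMod.natCast_zmod_val] at this
    have h5 : ∀ b, x.2 b = x.2 0 := fun b => by
      have := (h3 b.val).2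
      rwa [ZMod.natCast_zmod_val] at this
  · exact Prod.ext (Equiv.ext fun b => (h4 b).symm) (funext fun b => (h5 b).symm)
  · have hS0 : S x = 0 := by
      simp only [S]
      rw [Finset.sum_congr rfl fun b _ => h5 b]
      simp
    have hs : x.1 = Equiv.addRight (x.1 0) := Equiv.ext h4
    rw [if_pos hS0]
    congr 1
    simp only [w]
    rw [hs, sign_addRight_zmod hp, Finset.prod_mul_distrib,
      ← AddChar.map_finset_sum]
    simp only [Equiv.coe_addRight, add_sub_cancel_left, zero_add]
    rw [Finset.sum_congr rfl fun b _ => by rw [h5 b], ← Finset.mul_sum, sum_zmod_eq_zero hp,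
      Finset.prod_congr rfl fun b _ => by rw [h5 b]]
    simp

/-- The determinant of the `p`-dimensional representation of the Heisenberg group attached to `ψ`
is congruent modulo `p` to the sum of the coefficients. -/
theorem dvd_det_rep_sub_sum {R : Type*} [CommRing R] [IsDomain R] {p : ℕ} [Fact p.Prime]
    (hp : Odd p) (ψ : AddChar (ZMod p) R) (hψ : ∀ s, s ≠ 0 → ψ s ≠ 1)
    (f : ZMod p → ZMod p → ZMod p → ℤ) :
    (p : R) ∣ (Matrix.of fun b b' : ZMod p =>
        ∑ a, ∑ c, (f a (b - b') c : R) * ψ (c + a * b')).det -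
      ((∑ a, ∑ b, ∑ c, f a b c : ℤ) : R) := by
  -- Otherwise R/(p) would be the zero ring and not of characteristic `p`.
  by_cases hu : IsUnit (p : R)
  · exact hu.dvd
  have h := dvd_det_twisted_sub_sum_pow hp ψ hψ fun β a => ∑ c, (f a β c : R) * ψ c
  have hmat : (Matrix.of fun b b' : ZMod p =>
        ∑ a, ∑ c, (f a (b - b') c : R) * ψ (c + a * b')) =
      Matrix.of fun b b' : ZMod p => ∑ a, (∑ c, (f a (b - b') c : R) * ψ c) * ψ (a * b') := by
    ext b b'
    simp only [Matrix.of_apply, Finset.sum_mul, AddChar.map_add_eq_mul, mul_assoc]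
  rw [hmat]
  refine (dvd_iff_dvd_of_dvd_sub ?_).mp h
  rw [sub_sub_sub_cancel_left]
  have := CharP.quotient R p hu
  rw [← Ideal.mem_span_singleton, ← Ideal.Quotient.eq]
  rw [map_intCast]
  -- Frobenius is additive in R/(p), fixes the integer coefficients and sends `ψ c` to ψ(pc) = 1.
  simp only [map_sum, map_pow, sum_pow_char, map_mul, mul_pow, map_intCast]
  push_cast
  rw [Finset.sum_comm]
  refine Finset.sum_congr rfl fun a _ => Finset.sum_congr rfl fun b _ =>
    Finset.sum_congr rfl fun c _ => ?_
  rw [← map_pow, ← AddChar.map_nsmul_eq_pow]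
  have hf : ((f b a c : ℤ) : R ⧸ Ideal.span {(p : R)}) ^ p = (f b a c : ℤ) := by
    have := congrArg (ZMod.castHom dvd_rfl (R ⧸ Ideal.span {(p : R)}))
      (ZMod.pow_card (f b a c : ZMod p))
    rwa [map_pow, map_intCast] at this
  simp [hf]

/-! ### Coordinates and factorization of the group determinant -/

/-- The element of the Heisenberg group with entries `a`, `b`, `c`. -/
def heisenbergGroup.mk {R : Type*} [CommRing R] (a b c : R) : heisenbergGroup R :=
  ⟨⟨!![1, a, c; 0, 1, b; 0, 0, 1], by simp [Matrix.det_fin_three]⟩, ⟨a, b, c, rfl⟩⟩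

theorem heisenbergGroup.mk_mul_mk {R : Type*} [CommRing R] (a b c a' b' c' : R) :
    mk a b c * mk a' b' c' = mk (a' + a) (b' + b) (c' + a * b' + c) := by
  apply Subtype.ext
  apply Subtype.ext
  rw [Subgroup.coe_mul, Matrix.SpecialLinearGroup.coe_mul]
  simp only [mk]
  ext i j; fin_cases i <;> fin_cases j <;> simp [Matrix.mul_apply, Fin.sum_univ_three]

/-- For fixed `b` and `b'` this depends only on the differences of the (a, c) coordinates: the group
matrix consists of convolution blocks over the abelian subgroup b = 0. -/
theorem heisenbergGroup.mk_mul_inv_mk {R : Type*} [CommRing R] (a b c a' b' c' : R) :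
    mk a b c * (mk a' b' c')⁻¹ = mk (a - a') (b - b') (c - c' - (a - a') * b') := by
  rw [mul_inv_eq_iff_eq_mul, mk_mul_mk]
  congr 1 <;> ring

/-- Coordinates `(b, (a, c))` on the Heisenberg group. -/
def heisenbergGroup.coordEquiv (R : Type*) [CommRing R] : R × (R × R) ≃ heisenbergGroup R where
  toFun x := mk x.2.1 x.1 x.2.2
  invFun g := (g.1.1 1 2, (g.1.1 0 1, g.1.1 0 2))
  left_inv x := by simp [mk]
  right_inv g := by
    obtain ⟨g, a, b, c, h⟩ := g
    apply Subtype.ext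
    apply Subtype.ext
    simp [mk, h]

/-- The character `(a, c) ↦ ψ (u.1 * a + u.2 * c)` of the square of a ring. -/
def AddChar.pairing {A R : Type*} [CommRing A] [CommRing R] (ψ : AddChar A R) (u : A × A) :
    AddChar (A × A) R :=
  ψ.compAddMonoidHom ((AddMonoidHom.mulLeft u.1).coprod (AddMonoidHom.mulLeft u.2))

theorem AddChar.pairing_apply {A R : Type*} [CommRing A] [CommRing R] (ψ : AddChar A R)
    (u v : A × A) : ψ.pairing u v = ψ (u.1 * v.1 + u.2 * v.2) := rfl

theorem AddChar.injective_of_ne_one {A R : Type*} [AddCommGroup A] [CommRing R]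
    {ψ : AddChar A R} (hψ : ∀ s, s ≠ 0 → ψ s ≠ 1) : Function.Injective ψ := by
  intro s t h
  by_contra hst
  refine hψ (s - t) (sub_ne_zero.mpr hst) ?_
  rw [sub_eq_add_neg, map_add_eq_mul, h, ← map_add_eq_mul, add_neg_cancel, map_zero_eq_one]

theorem AddChar.pairing_injective {A R : Type*} [CommRing A] [CommRing R] {ψ : AddChar A R}
    (hψ : ∀ s, s ≠ 0 → ψ s ≠ 1) : Function.Injective ψ.pairing := by
  intro u v h
  have h1 := DFunLike.congr_fun h (1, 0)
  have h2 := DFunLike.congr_fun h (0, 1)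
  simp only [pairing_apply, mul_one, mul_zero, add_zero, zero_add] at h1 h2
  exact Prod.ext (injective_of_ne_one hψ h1) (injective_of_ne_one hψ h2)

theorem AddChar.mulShift_injective {A R : Type*} [CommRing A] [CommRing R] {ψ : AddChar A R}
    (hψ : ∀ s, s ≠ 0 → ψ s ≠ 1) : Function.Injective ψ.mulShift := by
  intro u v h
  have h1 := DFunLike.congr_fun h 1
  simp only [mulShift_apply, mul_one] at h1
  exact injective_of_ne_one hψ h1

/-- The group determinant of the Heisenberg group over `ZMod p`, after a Fourier transform in
the first and third coordinates. -/
theorem cast_groupDet_eq_prod {p : ℕ} [Fact p.Prime] {R : Type*} [CommRing R] [IsDomain R]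
    (ψ : AddChar (ZMod p) R) (hψ : ∀ s, s ≠ 0 → ψ s ≠ 1)
    (F : MonoidAlgebra ℤ (heisenbergGroup (ZMod p))) :
    (groupDet F : R) = ∏ s, ∏ k, (Matrix.of fun i j : ZMod p => ∑ a, ∑ c,
      (F.coeff (heisenbergGroup.mk a (i - j) c) : R) * ψ (s * a + k * (c + a * j))).det := by
  have h := det_block_convolution (ι := ZMod p) ψ.pairing (AddChar.pairing_injective hψ)
    fun i j v => (F.coeff (heisenbergGroup.mk v.1 (i - j) (v.2 - v.1 * j)) : R)
  rw [Fintype.prod_prod_type] at h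
  rw [groupDet, ← Matrix.det_submatrix_equiv_self (heisenbergGroup.coordEquiv (ZMod p)),
    Int.cast_det]
  refine Eq.trans (congrArg Matrix.det ?_) (h.trans ?_)
  · ext x y
    simp [heisenbergGroup.coordEquiv, heisenbergGroup.mk_mul_inv_mk]
  · refine Finset.prod_congr rfl fun s _ => Finset.prod_congr rfl fun k _ =>
      congrArg Matrix.det ?_
    ext i j
    simp only [Matrix.of_apply, AddChar.pairing_apply, Fintype.sum_prod_type]
    refine Finset.sum_congr rfl fun a _ => ?_
    -- Substituting in `c` moves the twist `a * j` from the coefficient into the character.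
    exact Fintype.sum_equiv (Equiv.subRight (a * j)) _ _ fun c => by simp

/-- The group determinant of the Heisenberg group over `ZMod p` is the product over the linear
characters and over the representations of degree `p`. -/
theorem cast_groupDet {p : ℕ} [Fact p.Prime] {R : Type*} [CommRing R] [IsDomain R]
    (ψ : AddChar (ZMod p) R) (hψ : ∀ s, s ≠ 0 → ψ s ≠ 1)
    (F : MonoidAlgebra ℤ (heisenbergGroup (ZMod p))) :
    (groupDet F : R) =
      (∏ u : ZMod p × ZMod p, ∑ a, ∑ b, ∑ c,
        (F.coeff (heisenbergGroup.mk a b c) : R) * ψ (u.1 * a + u.2 * b)) *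
      ∏ k ∈ Finset.univ.erase 0, (Matrix.of fun i j : ZMod p => ∑ a, ∑ c,
        (F.coeff (heisenbergGroup.mk a (i - j) c) : R) * ψ.mulShift k (c + a * j)).det ^ p := by
  rw [cast_groupDet_eq_prod ψ hψ, Finset.prod_comm,
    ← Finset.mul_prod_erase Finset.univ _ (Finset.mem_univ (0 : ZMod p))]
  congr 1
  · rw [Fintype.prod_prod_type]
    refine Finset.prod_congr rfl fun s _ => ?_
    have h := det_convolution ψ.mulShift (AddChar.mulShift_injective hψ) fun b => ∑ a, ∑ c,
      (F.coeff (heisenbergGroup.mk a b c) : R) * ψ (s * a)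
    simp only [zero_mul, add_zero]
    rw [h]
    refine Finset.prod_congr rfl fun r _ => ?_
    rw [Finset.sum_comm]
    refine Finset.sum_congr rfl fun b _ => ?_
    simp only [Finset.sum_mul, AddChar.mulShift_apply, AddChar.map_add_eq_mul, mul_assoc]
  · refine Finset.prod_congr rfl fun k hk => ?_
    have hk0 : k ≠ 0 := Finset.ne_of_mem_erase hk
    rw [Finset.prod_eq_pow_card (b := (Matrix.of fun i j : ZMod p => ∑ a, ∑ c,
        (F.coeff (heisenbergGroup.mk a (i - j) c) : R) * ψ.mulShift k (c + a * j)).det)]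
    · simp
    · intro s _
      -- As k ≠ 0, shifting rows and columns by s/k absorbs `s`: the `p` values of `s` give the same
      -- determinant.
      rw [← Matrix.det_submatrix_equiv_self (Equiv.subRight (s * k⁻¹))]
      congr 1
      ext i j
      simp only [Matrix.submatrix_apply, Matrix.of_apply, Equiv.subRight_apply,
        sub_sub_sub_cancel_right, AddChar.mulShift_apply]
      refine Finset.sum_congr rfl fun a _ => Finset.sum_congr rfl fun c _ => ?_
      congr 2
      field_simp
      ring

/-! ### Arithmetic of ζ - 1 and `p` -/

section PrimitiveRoot

theorem zmodChar_ne_one {R : Type*} [CommRing R] {p : ℕ} [NeZero p] {ζ : R}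
    (hζ : IsPrimitiveRoot ζ p) (s : ZMod p) (hs : s ≠ 0) :
    AddChar.zmodChar p hζ.pow_eq_one s ≠ 1 := by
  rw [AddChar.zmodChar_apply]
  exact hζ.pow_ne_one_of_pos_of_lt (by simpa using hs) (ZMod.val_lt s)

theorem sub_one_dvd_zmodChar_sub_one {R : Type*} [CommRing R] {p : ℕ} [NeZero p] {ζ : R}
    (hζ : IsPrimitiveRoot ζ p) (s : ZMod p) :
    ζ - 1 ∣ AddChar.zmodChar p hζ.pow_eq_one s - 1 := by
  rw [AddChar.zmodChar_apply]
  simpa using sub_dvd_pow_sub_pow ζ 1 s.val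

/-- ζ is a power of ζ^s with exponent inverse to `s`; so all ζ^s - 1 with s ≠ 0 are associates. -/
theorem zmodChar_sub_one_dvd_sub_one {R : Type*} [CommRing R] {p : ℕ} [Fact p.Prime] {ζ : R}
    (hζ : IsPrimitiveRoot ζ p) {s : ZMod p} (hs : s ≠ 0) :
    AddChar.zmodChar p hζ.pow_eq_one s - 1 ∣ ζ - 1 := by
  have h : ζ = AddChar.zmodChar p hζ.pow_eq_one s ^ (s⁻¹).val := by
    rw [← AddChar.map_nsmul_eq_pow, nsmul_eq_mul, ZMod.natCast_zmod_val, inv_mul_cancel₀ hs,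
      AddChar.zmodChar_apply, ZMod.val_one, pow_one]
  have h' := sub_dvd_pow_sub_pow (AddChar.zmodChar p hζ.pow_eq_one s) 1 (s⁻¹).val
  rwa [← h, one_pow] at h'

/-- First-order expansion of ζ^s at 1. Its term linear in `s` singles out the characters whose
factor gains a second ζ - 1. -/
theorem sub_one_sq_dvd_zmodChar_sub {R : Type*} [CommRing R] {p : ℕ} [NeZero p] {ζ : R}
    (hζ : IsPrimitiveRoot ζ p) (s : ZMod p) :
    (ζ - 1) ^ 2 ∣ AddChar.zmodChar p hζ.pow_eq_one s - 1 - s.val * (ζ - 1) := by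
  rw [AddChar.zmodChar_apply]
  induction s.val with
  | zero => simp
  | succ n ih =>
    have h : ζ ^ (n + 1) - 1 - ((n + 1 : ℕ) : R) * (ζ - 1) =
        (ζ ^ n - 1 - n * (ζ - 1)) + (ζ - 1) * (ζ ^ n - 1 ^ n) := by
      push_cast
      ring
    rw [h]
    refine dvd_add ih ?_
    rw [sq]
    exact mul_dvd_mul_left _ (sub_dvd_pow_sub_pow ζ 1 n)

theorem prod_zmodChar_sub_one {R : Type*} [CommRing R] [IsDomain R] {p : ℕ} [Fact p.Prime]
    (hp : Odd p) {ζ : R} (hζ : IsPrimitiveRoot ζ p) :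
    ∏ s ∈ Finset.univ.erase (0 : ZMod p), (AddChar.zmodChar p hζ.pow_eq_one s - 1) = p := by
  obtain ⟨n, rfl⟩ : ∃ n, p = n + 1 := ⟨p - 1, (Nat.succ_pred_prime Fact.out).symm⟩
  have h := hζ.prod_pow_sub_one_eq_order
  have hn : Even n := by
    rcases Nat.even_or_odd n with h | h
    · exact h
    · exact absurd hp (Nat.not_odd_iff_even.mpr h.add_one)
  rw [hn.neg_one_pow, one_mul] at h
  push_cast
  rw [← h]
  -- The known product has factors ζ^(k+1) - 1 for k < p - 1, hence the shift by one.
  refine Finset.prod_bij' (fun s _ => s.val - 1) (fun k _ => ((k + 1 : ℕ) : ZMod (n + 1)))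
    ?_ ?_ ?_ ?_ ?_
  · intro s hs
    have h1 : s.val ≠ 0 := by simpa using hs
    have h2 := ZMod.val_lt s
    simp only [Finset.mem_range]
    omega
  · intro k hk
    have hk' : k < n := Finset.mem_range.mp hk
    refine Finset.mem_erase.mpr ⟨fun h0 => ?_, Finset.mem_univ _⟩
    rw [ZMod.natCast_eq_zero_iff] at h0
    exact absurd (Nat.le_of_dvd (by omega) h0) (by omega)
  · intro s hs
    have h1 : s.val ≠ 0 := by simpa using hs
    rw [Nat.sub_add_cancel (Nat.one_le_iff_ne_zero.mpr h1), ZMod.natCast_zmod_val]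
  · intro k hk
    have hk' : k < n := Finset.mem_range.mp hk
    rw [ZMod.val_natCast_of_lt (by omega), Nat.add_sub_cancel]
  · intro s hs
    have h1 : s.val ≠ 0 := by simpa using hs
    rw [AddChar.zmodChar_apply, Nat.sub_add_cancel (Nat.one_le_iff_ne_zero.mpr h1)]

theorem card_erase_zero_zmod (p : ℕ) [NeZero p] :
    (Finset.univ.erase (0 : ZMod p)).card = p - 1 := by
  rw [Finset.card_erase_of_mem (Finset.mem_univ _), Finset.card_univ, ZMod.card]

theorem sub_one_pow_dvd_prime {R : Type*} [CommRing R] [IsDomain R] {p : ℕ} [Fact p.Prime]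
    (hp : Odd p) {ζ : R} (hζ : IsPrimitiveRoot ζ p) : (ζ - 1) ^ (p - 1) ∣ (p : R) := by
  rw [← prod_zmodChar_sub_one hp hζ, ← card_erase_zero_zmod, ← Finset.prod_const]
  exact Finset.prod_dvd_prod_of_dvd _ _ fun s _ => sub_one_dvd_zmodChar_sub_one hζ s

theorem prime_dvd_sub_one_pow {R : Type*} [CommRing R] [IsDomain R] {p : ℕ} [Fact p.Prime]
    (hp : Odd p) {ζ : R} (hζ : IsPrimitiveRoot ζ p) : (p : R) ∣ (ζ - 1) ^ (p - 1) := by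
  rw [← prod_zmodChar_sub_one hp hζ, ← card_erase_zero_zmod, ← Finset.prod_const]
  exact Finset.prod_dvd_prod_of_dvd _ _ fun s hs =>
    zmodChar_sub_one_dvd_sub_one hζ (Finset.ne_of_mem_erase hs)

theorem three_le_of_odd_prime {p : ℕ} [hpp : Fact p.Prime] (hp : Odd p) : 3 ≤ p := by
  have := hpp.out.two_le
  obtain ⟨k, hk⟩ := hp
  omega

theorem sub_one_sq_dvd_prime {R : Type*} [CommRing R] [IsDomain R] {p : ℕ} [Fact p.Prime]
    (hp : Odd p) {ζ : R} (hζ : IsPrimitiveRoot ζ p) : (ζ - 1) ^ 2 ∣ (p : R) :=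
  (pow_dvd_pow _ (by have := three_le_of_odd_prime hp; omega)).trans
    (sub_one_pow_dvd_prime hp hζ)

/-- A rational integer divisible by the prime above `p` is divisible by `p`. -/
theorem prime_dvd_of_sub_one_dvd_intCast {R : Type*} [CommRing R] [IsDomain R] {p : ℕ}
    [hpp : Fact p.Prime] (hp : Odd p) {ζ : R} (hζ : IsPrimitiveRoot ζ p) (hπ : Prime (ζ - 1))
    {n : ℤ} (hn : ζ - 1 ∣ (n : R)) : (p : ℤ) ∣ n := by
  by_contra h
  obtain ⟨a, b, hab⟩ := ((Nat.prime_iff_prime_int.mp hpp.out).coprime_iff_not_dvd).mpr h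
  refine hπ.not_isUnit (isUnit_of_dvd_one ?_)
  have h1 : ((a * p + b * n : ℤ) : R) = 1 := by rw [hab]; simp
  have h2 : ζ - 1 ∣ ((a * p + b * n : ℤ) : R) := by
    push_cast
    exact dvd_add (((dvd_pow_self _ two_ne_zero).trans (sub_one_sq_dvd_prime hp hζ)).mul_left _)
      (hn.mul_left _)
  rwa [h1] at h2

end PrimitiveRoot

/-! ### Linear characters -/

section LinearCharacters

theorem sub_one_dvd_character_sum_sub {R : Type*} [CommRing R] {p : ℕ} [NeZero p] {ζ : R}
    (hζ : IsPrimitiveRoot ζ p) (g : ZMod p → ZMod p → ℤ) (u : ZMod p × ZMod p) :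
    ζ - 1 ∣ ∑ a, ∑ b, (g a b : R) * AddChar.zmodChar p hζ.pow_eq_one (u.1 * a + u.2 * b) -
      ((∑ a, ∑ b, g a b : ℤ) : R) := by
  push_cast
  simp only [← Finset.sum_sub_distrib]
  refine Finset.dvd_sum fun a _ => Finset.dvd_sum fun b _ => ?_
  rw [← mul_sub_one]
  exact (sub_one_dvd_zmodChar_sub_one hζ _).mul_left _

/-- Modulo π² the difference is π times an integer reducing modulo `p` to the linear form in `hu`;
that integer is then divisible by `p`, hence by π². -/
theorem sub_one_sq_dvd_character_sum_sub {R : Type*} [CommRing R] [IsDomain R] {p : ℕ}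
    [Fact p.Prime] (hp : Odd p) {ζ : R} (hζ : IsPrimitiveRoot ζ p) (g : ZMod p → ZMod p → ℤ)
    (u : ZMod p × ZMod p)
    (hu : u.1 * (∑ a, ∑ b, (g a b : ZMod p) * a) + u.2 * (∑ a, ∑ b, (g a b : ZMod p) * b) = 0) :
    (ζ - 1) ^ 2 ∣ ∑ a, ∑ b, (g a b : R) * AddChar.zmodChar p hζ.pow_eq_one (u.1 * a + u.2 * b) -
      ((∑ a, ∑ b, g a b : ℤ) : R) := by
  have h1 : (p : ℤ) ∣ ∑ a, ∑ b, g a b * ((u.1 * a + u.2 * b).val : ℤ) := by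
    rw [← ZMod.intCast_zmod_eq_zero_iff_dvd]
    push_cast
    simp only [ZMod.natCast_zmod_val]
    rw [← hu]
    simp only [Finset.mul_sum, ← Finset.sum_add_distrib]
    refine Finset.sum_congr rfl fun a _ => Finset.sum_congr rfl fun b _ => ?_
    ring
  have h2 : (ζ - 1) ^ 2 ∣ ((∑ a, ∑ b, g a b * ((u.1 * a + u.2 * b).val : ℤ) : ℤ) : R) := by
    refine (sub_one_sq_dvd_prime hp hζ).trans ?_
    simpa using map_dvd (Int.castRingHom R) h1
  rw [← dvd_sub_left (h2.mul_right (ζ - 1))]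
  push_cast
  simp only [Finset.sum_mul, ← Finset.sum_sub_distrib]
  refine Finset.dvd_sum fun a _ => Finset.dvd_sum fun b _ => ?_
  have h3 := (sub_one_sq_dvd_zmodChar_sub hζ (u.1 * a + u.2 * b)).mul_left (g a b : R)
  convert h3 using 1
  ring

/-- The contribution of the linear characters to the group determinant. -/
theorem prime_pow_dvd_prod_character_sum {R : Type*} [CommRing R] [IsDomain R] {p : ℕ}
    [hpp : Fact p.Prime] (hp : Odd p) {ζ : R} (hζ : IsPrimitiveRoot ζ p)
    (g : ZMod p → ZMod p → ℤ) (hg : (p : ℤ) ∣ ∑ a, ∑ b, g a b) :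
    (p : R) ^ (p + 3) ∣ ∏ u : ZMod p × ZMod p,
      ∑ a, ∑ b, (g a b : R) * AddChar.zmodChar p hζ.pow_eq_one (u.1 * a + u.2 * b) := by
  set A : ZMod p := ∑ a, ∑ b, (g a b : ZMod p) * a with hA
  set B : ZMod p := ∑ a, ∑ b, (g a b : ZMod p) * b with hB
  have hg' : (p : R) ∣ ((∑ a, ∑ b, g a b : ℤ) : R) := by
    simpa using map_dvd (Int.castRingHom R) hg
  have hsq := (sub_one_sq_dvd_prime hp hζ).trans hg'
  -- A linear form in two variables over a field has a nonzero zero; its p - 1 nonzero multiples are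
  -- the gaining characters.
  obtain ⟨v, hv0, hv⟩ : ∃ v : ZMod p × ZMod p, v ≠ 0 ∧ v.1 * A + v.2 * B = 0 := by
    by_cases hAB : A = 0 ∧ B = 0
    · exact ⟨(0, 1), by simp, by simp [hAB]⟩
    · exact ⟨(B, -A), by simpa [Prod.ext_iff, and_comm] using hAB, by ring⟩
  let e : ZMod p × ZMod p → ℕ := fun u => 1 + if u.1 * A + u.2 * B = 0 then 1 else 0
  have he : ∀ u, (ζ - 1) ^ e u ∣
      ∑ a, ∑ b, (g a b : R) * AddChar.zmodChar p hζ.pow_eq_one (u.1 * a + u.2 * b) := by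
    intro u
    by_cases hu : u.1 * A + u.2 * B = 0
    · simp only [e, if_pos hu]
      exact (dvd_iff_dvd_of_dvd_sub (sub_one_sq_dvd_character_sum_sub hp hζ g u hu)).mpr hsq
    · simp only [e, if_neg hu, add_zero, pow_one]
      exact (dvd_iff_dvd_of_dvd_sub (sub_one_dvd_character_sum_sub hζ g u)).mpr
        ((dvd_pow_self _ two_ne_zero).trans hsq)
  have hcard : p - 1 ≤ ((Finset.univ.erase (0 : ZMod p × ZMod p)).filter
      fun u => u.1 * A + u.2 * B = 0).card := by
    rw [← card_erase_zero_zmod p]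
    refine Finset.card_le_card_of_injOn (fun t => t • v) ?_ ?_
    · intro t ht
      have ht' : t ≠ 0 := Finset.ne_of_mem_erase ht
      simp only [Finset.coe_filter, Finset.mem_erase, Finset.mem_univ, and_true, Set.mem_ofPred_eq]
      refine ⟨smul_ne_zero ht' hv0, ?_⟩
      simp only [Prod.smul_fst, Prod.smul_snd, smul_eq_mul]
      linear_combination t * hv
    · intro s _ t _ hst
      exact smul_left_injective _ hv0 hst
  -- The count is (p² - 1) + (p - 1).
  have hsum : (p - 1) * (p + 2) ≤ ∑ u ∈ Finset.univ.erase (0 : ZMod p × ZMod p), e u := by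
    simp only [e, Finset.sum_add_distrib, Finset.sum_const, smul_eq_mul, mul_one,
      Finset.sum_boole, Nat.cast_id]
    rw [Finset.card_erase_of_mem (Finset.mem_univ _), Finset.card_univ, Fintype.card_prod,
      ZMod.card]
    refine le_trans (le_of_eq ?_) (Nat.add_le_add_left hcard _)
    obtain ⟨n, rfl⟩ : ∃ n, p = n + 1 := ⟨p - 1, (Nat.succ_pred_prime hpp.out).symm⟩
    have : (n + 1) * (n + 1) - 1 = n * (n + 2) := by
      rw [Nat.sub_eq_iff_eq_add (by nlinarith)]; ring
    rw [this, Nat.add_sub_cancel]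
    ring
  rw [← Finset.mul_prod_erase Finset.univ _ (Finset.mem_univ (0 : ZMod p × ZMod p)),
    show p + 3 = 1 + (p + 2) by ring, pow_add, pow_one]
  refine mul_dvd_mul (by simpa using hg') ?_
  refine (pow_dvd_pow_of_dvd (prime_dvd_sub_one_pow hp hζ) (p + 2)).trans ?_
  rw [← pow_mul]
  refine (pow_dvd_pow _ hsum).trans ?_
  rw [← Finset.prod_pow_eq_pow_sum]
  exact Finset.prod_dvd_prod_of_dvd _ _ fun u _ => he u

end LinearCharacters

/-! ### Divisibility of the group determinant -/

/-- The prime `p` divides the group determinant only if it divides the sum of the coefficients. -/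
theorem prime_dvd_sum_of_dvd_groupDet {R : Type*} [CommRing R] [IsDomain R] {p : ℕ}
    [hpp : Fact p.Prime] (hp : Odd p) {ζ : R} (hζ : IsPrimitiveRoot ζ p) (hπ : Prime (ζ - 1))
    (F : MonoidAlgebra ℤ (heisenbergGroup (ZMod p))) (hF : (p : ℤ) ∣ groupDet F) :
    (p : ℤ) ∣ ∑ a, ∑ b, ∑ c, F.coeff (heisenbergGroup.mk a b c) := by
  have hpπ : ζ - 1 ∣ (p : R) := (dvd_pow_self _ two_ne_zero).trans (sub_one_sq_dvd_prime hp hζ)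
  have h : ζ - 1 ∣ (groupDet F : R) :=
    hpπ.trans (by simpa using map_dvd (Int.castRingHom R) hF)
  apply prime_dvd_of_sub_one_dvd_intCast hp hζ hπ
  rw [cast_groupDet _ (zmodChar_ne_one hζ) F] at h
  rcases hπ.dvd_or_dvd h with h | h
  · obtain ⟨u, -, hu⟩ := hπ.exists_mem_finset_dvd h
    have h1 := sub_one_dvd_character_sum_sub hζ
      (fun a b => ∑ c, F.coeff (heisenbergGroup.mk a b c)) u
    push_cast at h1 ⊢
    simp only [Finset.sum_mul] at h1
    exact (dvd_iff_dvd_of_dvd_sub h1).mp hu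
  · obtain ⟨k, hk, hu⟩ := hπ.exists_mem_finset_dvd h
    have hk0 : k ≠ 0 := Finset.ne_of_mem_erase hk
    have h1 := dvd_det_rep_sub_sum hp ((AddChar.zmodChar p hζ.pow_eq_one).mulShift k)
      (fun s hs => zmodChar_ne_one hζ _ (mul_ne_zero hk0 hs))
      fun a b c => F.coeff (heisenbergGroup.mk a b c)
    exact (dvd_iff_dvd_of_dvd_sub (hpπ.trans h1)).mp (hπ.dvd_of_dvd_pow hu)

/-- If `p` divides the sum of the coefficients then `p ^ (p ^ 2 + 3)` divides the group
determinant. -/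
theorem prime_pow_dvd_groupDet {R : Type*} [CommRing R] [IsDomain R] {p : ℕ}
    [hpp : Fact p.Prime] (hp : Odd p) {ζ : R} (hζ : IsPrimitiveRoot ζ p)
    (F : MonoidAlgebra ℤ (heisenbergGroup (ZMod p)))
    (hF : (p : ℤ) ∣ ∑ a, ∑ b, ∑ c, F.coeff (heisenbergGroup.mk a b c)) :
    (p : R) ^ (p ^ 2 + 3) ∣ (groupDet F : R) := by
  have hexp : p ^ 2 + 3 = (p + 3) + p * (p - 1) := by
    obtain ⟨n, rfl⟩ : ∃ n, p = n + 1 := ⟨p - 1, (Nat.succ_pred_prime hpp.out).symm⟩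
    rw [Nat.add_sub_cancel]
    ring
  rw [cast_groupDet _ (zmodChar_ne_one hζ) F, hexp, pow_add]
  refine mul_dvd_mul ?_ ?_
  · have h1 := prime_pow_dvd_prod_character_sum hp hζ
      (fun a b => ∑ c, F.coeff (heisenbergGroup.mk a b c)) hF
    push_cast at h1
    simpa only [Finset.sum_mul] using h1
  · rw [pow_mul, ← card_erase_zero_zmod, ← Finset.prod_const]
    refine Finset.prod_dvd_prod_of_dvd _ _ fun k hk => pow_dvd_pow_of_dvd ?_ p
    have hk0 : k ≠ 0 := Finset.ne_of_mem_erase hk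
    have h1 := dvd_det_rep_sub_sum hp ((AddChar.zmodChar p hζ.pow_eq_one).mulShift k)
      (fun s hs => zmodChar_ne_one hζ _ (mul_ne_zero hk0 hs))
      fun a b c => F.coeff (heisenbergGroup.mk a b c)
    refine (dvd_iff_dvd_of_dvd_sub h1).mpr ?_
    simpa using map_dvd (Int.castRingHom R) hF

/-! ### Sharpness: the element y - f(x) -/

/-- The determinant of a cyclic bidiagonal matrix of odd size. -/
theorem det_shift_sub_diagonal {R : Type*} [CommRing R] {p : ℕ} [hpp : Fact p.Prime] (hp : Odd p)
    (d : ZMod p → R) :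
    (Matrix.of fun i j : ZMod p =>
      (if i - j = 1 then (1 : R) else 0) - if i - j = 0 then d j else 0).det = 1 - ∏ j, d j := by
  classical
  have hne : (1 : Equiv.Perm (ZMod p)) ≠ Equiv.addRight 1 := by
    intro h
    simpa using DFunLike.congr_fun h 0
  rw [Matrix.det_apply', ← Finset.sum_subset
    (Finset.subset_univ {(1 : Equiv.Perm (ZMod p)), Equiv.addRight 1}), Finset.sum_pair hne]
  · rw [sign_addRight_zmod hp]
    simp [Finset.prod_neg, hp.neg_one_pow, ZMod.card]
    ring
  · intro σ _ hσ
    by_contra h0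
    have h1 : ∀ i, σ i = i ∨ σ i = i + 1 := by
      intro i
      by_contra hi
      rw [not_or] at hi
      refine h0 (mul_eq_zero_of_right _ (Finset.prod_eq_zero (Finset.mem_univ i) ?_))
      rw [Matrix.of_apply, if_neg, if_neg, sub_zero]
      · exact fun h => hi.1 (sub_eq_zero.mp h)
      · exact fun h => hi.2 (by rw [← h]; ring)
    refine hσ ?_
    rw [Finset.mem_insert, Finset.mem_singleton]
    by_cases h2 : ∃ i, σ i = i + 1
    · right
      obtain ⟨i, hi⟩ := h2
      have h3 : ∀ k : ℕ, σ (i + k) = i + k + 1 := by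
        intro k
        induction k with
        | zero => simpa using hi
        | succ k ih =>
          push_cast
          rw [← add_assoc]
          refine (h1 _).resolve_left fun h => ?_
          have := σ.injective (h.trans ih.symm)
          simp at this
      ext j
      have h4 := h3 (j - i).val
      rw [ZMod.natCast_zmod_val, add_sub_cancel] at h4
      rw [h4, Equiv.coe_addRight]
    · left
      ext i
      rw [(h1 i).resolve_right fun h => h2 ⟨i, h⟩, Equiv.Perm.one_apply]

/-- The group determinant of `y - ∑ γ a x ^ a`. -/
theorem exists_groupDet_eq_prod {R : Type*} [CommRing R] [IsDomain R] {p : ℕ}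
    [hpp : Fact p.Prime] (hp : Odd p) {ψ : AddChar (ZMod p) R} (hψ : ∀ s, s ≠ 0 → ψ s ≠ 1)
    (γ : ZMod p → ℤ) :
    ∃ F : MonoidAlgebra ℤ (heisenbergGroup (ZMod p)),
      (groupDet F : R) = (∏ s, (1 - (∑ a, (γ a : R) * ψ (s * a)) ^ p)) *
        (1 - ∏ s, ∑ a, (γ a : R) * ψ (s * a)) ^ (p * (p - 1)) := by
  classical
  let f : ZMod p × (ZMod p × ZMod p) → ℤ := fun x => if x.2.2 = 0 then
    (if x.1 = 1 then (if x.2.1 = 0 then 1 else 0) else 0) - (if x.1 = 0 then γ x.2.1 else 0) else 0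
  let F : MonoidAlgebra ℤ (heisenbergGroup (ZMod p)) := .ofCoeff
    (Finsupp.equivFunOnFinite.symm fun g => f ((heisenbergGroup.coordEquiv (ZMod p)).symm g))
  have hF : ∀ a b c, F.coeff (heisenbergGroup.mk a b c) = f (b, (a, c)) := by
    intro a b c
    exact congrArg f ((heisenbergGroup.coordEquiv (ZMod p)).symm_apply_apply (b, (a, c)))
  refine ⟨F, ?_⟩
  set G : ZMod p → R := fun s => ∑ a, (γ a : R) * ψ (s * a) with hG
  have hdet : ∀ s k, (Matrix.of fun i j : ZMod p => ∑ a, ∑ c,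
      (F.coeff (heisenbergGroup.mk a (i - j) c) : R) * ψ (s * a + k * (c + a * j))).det =
        1 - ∏ j, G (s + k * j) := by
    intro s k
    rw [← det_shift_sub_diagonal hp]
    congr 1
    ext i j
    simp only [Matrix.of_apply, hF, f, hG]
    have h1 : ∀ a, ∑ c, ((if c = 0 then (if i - j = 1 then (if a = 0 then 1 else 0) else 0) -
        (if i - j = 0 then γ a else 0) else 0 : ℤ) : R) * ψ (s * a + k * (c + a * j)) =
        (if i - j = 1 then (if a = 0 then 1 else 0) else 0) -
          (if i - j = 0 then (γ a : R) * ψ ((s + k * j) * a) else 0) := by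
      intro a
      rw [Finset.sum_eq_single 0 (by intro c _ hc; simp [hc]) (by simp)]
      have h2 : s * a + k * (0 + a * j) = (s + k * j) * a := by ring
      rw [if_pos rfl, h2]
      push_cast
      by_cases ha : a = 0
      · subst ha
        split_ifs <;> simp
      · split_ifs <;> simp
    rw [Finset.sum_congr rfl fun a _ => h1 a, Finset.sum_sub_distrib]
    congr 1
    · split_ifs <;> simp
    · split_ifs <;> simp
  rw [cast_groupDet_eq_prod ψ hψ F]
  simp only [hdet]
  rw [Finset.prod_comm, ← Finset.mul_prod_erase Finset.univ _ (Finset.mem_univ (0 : ZMod p))]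
  congr 1
  · simp [hG, ZMod.card]
  · rw [pow_mul, ← card_erase_zero_zmod p]
    refine Finset.prod_eq_pow_card fun k hk => ?_
    have hk0 : k ≠ 0 := Finset.ne_of_mem_erase hk
    rw [Finset.prod_eq_pow_card (b := 1 - ∏ t, G t)]
    · simp
    · intro s _
      congr 1
      -- For k ≠ 0 the map j ↦ s + kj is a bijection, so the product does not depend on `s` or `k`.
      exact Fintype.prod_equiv ((Equiv.mulLeft₀ k hk0).trans (Equiv.addLeft s)) _ _ fun j => rfl

/-- The two lowest terms and the highest term of `(1 + x) ^ p`, modulo `p * x ^ 2`. -/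
theorem prime_mul_sq_dvd_one_add_pow_sub {R : Type*} [CommRing R] {p : ℕ} [hpp : Fact p.Prime]
    (x : R) : (p : R) * x ^ 2 ∣ (1 + x) ^ p - 1 - p * x - x ^ p := by
  obtain ⟨n, hn⟩ : ∃ n, p = n + 2 := ⟨p - 2, (Nat.sub_add_cancel hpp.out.two_le).symm⟩
  have h : (1 + x) ^ p - 1 - p * x - x ^ p =
      ∑ m ∈ Finset.range n, x ^ (m + 2) * (p.choose (m + 2) : R) := by
    rw [add_comm 1 x, add_pow, Finset.sum_range_succ, hn, Finset.sum_range_succ',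
      Finset.sum_range_succ']
    simp
    ring
  rw [h]
  refine Finset.dvd_sum fun m hm => ?_
  have hm' := Finset.mem_range.mp hm
  have h1 : p ∣ p.choose (m + 2) :=
    hpp.out.dvd_choose_self (by omega) (by omega)
  have h2 : (p : R) ∣ (p.choose (m + 2) : R) := by exact_mod_cast Nat.cast_dvd_cast h1
  rw [mul_comm (p : R)]
  exact mul_dvd_mul (pow_dvd_pow _ (by omega)) h2

/-- Binomially (1 + pk)^p ≡ 1 + p²k modulo p³; the last term (pk)^p is harmless because p ≥ 3. -/
theorem one_sub_one_add_prime_mul_pow {p : ℕ} [hpp : Fact p.Prime] (hp : Odd p) {k : ℤ}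
    (hk : ¬ (p : ℤ) ∣ k) : ∃ w : ℤ, 1 - (1 + p * k) ^ p = p ^ 2 * w ∧ ¬ (p : ℤ) ∣ w := by
  obtain ⟨y, hy⟩ := prime_mul_sq_dvd_one_add_pow_sub (p := p) ((p : ℤ) * k)
  obtain ⟨n, hn⟩ : ∃ n, p = n + 3 :=
    ⟨p - 3, (Nat.sub_add_cancel (three_le_of_odd_prime hp)).symm⟩
  have hpow : ((p : ℤ) * k) ^ p = p ^ 3 * (p ^ n * k ^ p) := by
    rw [mul_pow]
    nth_rewrite 2 [hn]
    ring
  refine ⟨-(k + p * (k ^ 2 * y + p ^ n * k ^ p)), ?_, ?_⟩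
  · rw [hpow] at hy
    linear_combination -hy
  · rw [dvd_neg]
    exact fun h => hk ((dvd_add_left (Dvd.intro _ rfl)).mp h)

/-- With π = ψ(s) - 1, the term pπ² dominates (1 + π²)^p - 1: the middle terms are divisible by pπ⁴,
and π^(2p) = π^(p-1) π^(p+1) by pπ³. -/
theorem one_sub_one_add_sq_pow {R : Type*} [CommRing R] [IsDomain R] {p : ℕ}
    [hpp : Fact p.Prime] (hp : Odd p) {ζ : R} (hζ : IsPrimitiveRoot ζ p) (hπ : Prime (ζ - 1))
    (s : ZMod p) :
    ∃ v : R, 1 - (1 + (AddChar.zmodChar p hζ.pow_eq_one s - 1) ^ 2) ^ p =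
      p * (AddChar.zmodChar p hζ.pow_eq_one s - 1) ^ 2 * v ∧ ¬ ζ - 1 ∣ v := by
  set π := AddChar.zmodChar p hζ.pow_eq_one s - 1 with hπs
  obtain ⟨n, hn⟩ : ∃ n, p = n + 3 :=
    ⟨p - 3, (Nat.sub_add_cancel (three_le_of_odd_prime hp)).symm⟩
  obtain ⟨y, hy⟩ := prime_mul_sq_dvd_one_add_pow_sub (p := p) (π ^ 2)
  have h1 : ζ - 1 ∣ π := sub_one_dvd_zmodChar_sub_one hζ s
  obtain ⟨z, hz⟩ := (prime_dvd_sub_one_pow hp hζ).trans (pow_dvd_pow_of_dvd h1 (p - 1))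
  have hpow : (π ^ 2) ^ p = p * π ^ 2 * (π * (π ^ (n + 1) * z)) := by
    have h2 : (π ^ 2) ^ p = π ^ (p - 1) * π ^ (n + 4) := by
      rw [← pow_mul, ← pow_add]
      congr 1
      omega
    rw [h2, hz]
    ring
  refine ⟨-(1 + π * (π * y + π ^ (n + 1) * z)), ?_, ?_⟩
  · rw [hpow] at hy
    linear_combination -hy
  · rw [dvd_neg]
    exact fun h => hπ.not_isUnit
      (isUnit_of_dvd_one ((dvd_add_left (h1.mul_right _)).mp h))

/-- The product of the values of `1 + (y - 1) ^ 2` at the `p`-th roots of unity is a rational integer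
congruent to `1` modulo `p`. -/
theorem exists_intCast_eq_prod_one_add_sq {R : Type*} [CommRing R] [IsDomain R] {p : ℕ}
    [hpp : Fact p.Prime] (hp : Odd p) {ζ : R} (hζ : IsPrimitiveRoot ζ p) (hπ : Prime (ζ - 1)) :
    ∃ N : ℤ, (N : R) = ∏ s, (1 + (AddChar.zmodChar p hζ.pow_eq_one s - 1) ^ 2) ∧
      (p : ℤ) ∣ N - 1 := by
  set ψ := AddChar.zmodChar p hζ.pow_eq_one with hψ
  -- Coefficients of 2 - 2x + x² = 1 + (x-1)²; the product is an integer because it is their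
  -- circulant determinant.
  let γ : ZMod p → ℤ := fun a =>
    (if a = 0 then 2 else 0) - (if a = 1 then 2 else 0) + if a = 2 then 1 else 0
  refine ⟨(Matrix.of fun x y : ZMod p => γ (x - y)).det, ?_⟩
  have hN : (((Matrix.of fun x y : ZMod p => γ (x - y)).det : ℤ) : R) =
      ∏ s, (1 + (ψ s - 1) ^ 2) := by
    have h := det_convolution ψ.mulShift
      (AddChar.mulShift_injective (zmodChar_ne_one hζ)) fun a => (γ a : R)
    rw [Int.cast_det]
    refine Eq.trans (congrArg Matrix.det ?_) (h.trans ?_)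
    · ext x y
      simp
    · refine Finset.prod_congr rfl fun s _ => ?_
      have h2 : ψ (s * 2) = ψ s ^ 2 := by
        rw [mul_two, AddChar.map_add_eq_mul, sq]
      simp [γ, add_mul, sub_mul, Finset.sum_add_distrib, Finset.sum_sub_distrib,
        AddChar.mulShift_apply, ite_mul, h2]
      ring
  refine ⟨hN, prime_dvd_of_sub_one_dvd_intCast hp hζ hπ ?_⟩
  rw [Int.cast_sub, Int.cast_one, hN, ← Ideal.mem_span_singleton, ← Ideal.Quotient.eq, map_prod,
    map_one]
  refine Finset.prod_eq_one fun s _ => ?_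
  rw [← map_one (Ideal.Quotient.mk _), Ideal.Quotient.eq, Ideal.mem_span_singleton,
    add_sub_cancel_left, sq]
  exact (sub_one_dvd_zmodChar_sub_one hζ s).mul_right _

/-- A group determinant which is exactly divisible by `p ^ (p ^ 2 + 3)`. -/
theorem exists_groupDet_eq_prime_pow_mul {R : Type*} [CommRing R] [IsDomain R] {p : ℕ}
    [hpp : Fact p.Prime] (hp : Odd p) {ζ : R} (hζ : IsPrimitiveRoot ζ p) (hπ : Prime (ζ - 1)) :
    ∃ (F : MonoidAlgebra ℤ (heisenbergGroup (ZMod p))) (v : R),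
      (groupDet F : R) = p ^ (p ^ 2 + 3) * v ∧ ¬ ζ - 1 ∣ v := by
  have hpi : Prime (p : ℤ) := Nat.prime_iff_prime_int.mp hpp.out
  have hp3 := three_le_of_odd_prime hp
  obtain ⟨N, hN, M, hM⟩ := exists_intCast_eq_prod_one_add_sq hp hζ hπ
  -- With N = 1 + pM one has m ≡ -(k + M) modulo `p`, so `k` must avoid 0 and -M; 1 or 2 does.
  obtain ⟨k, m, hk, hm, hkm⟩ : ∃ k m : ℤ, ¬ (p : ℤ) ∣ k ∧ ¬ (p : ℤ) ∣ m ∧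
      1 - (1 + p * k) * N = p * m := by
    have h1 : ¬ (p : ℤ) ∣ 1 := hpi.not_dvd_one
    have h2 : ¬ (p : ℤ) ∣ 2 := fun h => by
      have := Int.le_of_dvd (by norm_num) h
      omega
    have hNM : N = 1 + p * M := by linear_combination hM
    by_cases h : (p : ℤ) ∣ M + 1
    · refine ⟨2, -(M + 2 + p * (2 * M)), h2, fun h3 => h1 ?_, by rw [hNM]; ring⟩
      rw [dvd_neg, dvd_add_left (Dvd.intro _ rfl)] at h3
      have := dvd_sub h3 h
      rwa [show M + 2 - (M + 1) = 1 by ring] at this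
    · refine ⟨1, -(M + 1 + p * M), h1, fun h3 => h ?_, by rw [hNM]; ring⟩
      rwa [dvd_neg, dvd_add_left (Dvd.intro _ rfl)] at h3
  obtain ⟨w, hw, hpw⟩ := one_sub_one_add_prime_mul_pow hp hk
  set ψ := AddChar.zmodChar p hζ.pow_eq_one with hψ
  -- Adding `k` to all coefficients changes only the value at the trivial character, by pk.
  let γ : ZMod p → ℤ := fun a =>
    k + ((if a = 0 then 2 else 0) - (if a = 1 then 2 else 0) + if a = 2 then 1 else 0)
  obtain ⟨F, hF⟩ := exists_groupDet_eq_prod hp (zmodChar_ne_one hζ) γ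
  have hG : ∀ s, ∑ a, (γ a : R) * ψ (s * a) =
      k * ∑ a, ψ (s * a) + (1 + (ψ s - 1) ^ 2) := by
    intro s
    have h2 : ψ (s * 2) = ψ s ^ 2 := by
      rw [mul_two, AddChar.map_add_eq_mul, sq]
    simp [γ, add_mul, sub_mul, Finset.sum_add_distrib, Finset.sum_sub_distrib, ite_mul, h2,
      Finset.mul_sum]
    ring
  have hG0 : ∑ a, (γ a : R) * ψ (0 * a) = 1 + p * k := by
    rw [hG]
    simp [ZMod.card]
    ring
  have hG1 : ∀ s, s ≠ 0 → ∑ a, (γ a : R) * ψ (s * a) = 1 + (ψ s - 1) ^ 2 := by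
    intro s hs
    have h : ∑ a, ψ (s * a) = 0 := by
      refine AddChar.sum_eq_zero_of_ne_one (ψ := ψ.mulShift s) fun h => ?_
      have h' := DFunLike.congr_fun h 1
      rw [AddChar.mulShift_apply, mul_one] at h'
      exact zmodChar_ne_one hζ s hs h'
    rw [hG, h, mul_zero, zero_add]
  have hprod : ∏ s, ∑ a, (γ a : R) * ψ (s * a) = (1 + p * k) * N := by
    rw [hN, ← Finset.mul_prod_erase Finset.univ _ (Finset.mem_univ (0 : ZMod p)),
      ← Finset.mul_prod_erase Finset.univ (fun s => 1 + (ψ s - 1) ^ 2)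
        (Finset.mem_univ (0 : ZMod p)), hG0]
    congr 1
    rw [AddChar.map_zero_eq_one, sub_self, zero_pow two_ne_zero, add_zero, one_mul]
    exact Finset.prod_congr rfl fun s hs => hG1 s (Finset.ne_of_mem_erase hs)
  choose v hv hvπ using one_sub_one_add_sq_pow hp hζ hπ
  refine ⟨F, w * (∏ s ∈ Finset.univ.erase 0, v s) * m ^ (p * (p - 1)), ?_, ?_⟩
  · have hw' : (1 - (1 + p * k) ^ p : R) = p ^ 2 * w := by
      exact_mod_cast congrArg (Int.cast (R := R)) hw
    have hkm' : (1 - (1 + p * k) * N : R) = p * m := by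
      exact_mod_cast congrArg (Int.cast (R := R)) hkm
    rw [hF, hprod, hkm', ← Finset.mul_prod_erase Finset.univ _ (Finset.mem_univ (0 : ZMod p)),
      hG0, hw', Finset.prod_congr rfl fun s hs => by
        rw [hG1 s (Finset.ne_of_mem_erase hs), hv s],
      Finset.prod_mul_distrib, Finset.prod_mul_distrib, Finset.prod_pow,
      prod_zmodChar_sub_one hp hζ, Finset.prod_const, card_erase_zero_zmod]
    -- The summands come from s = 0, from the p - 1 factors pπ_s² whose π_s multiply to `p`, and
    -- from the degree-p representations.
    have hexp : p ^ 2 + 3 = 2 + ((p - 1) + 2) + p * (p - 1) := by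
      obtain ⟨n, rfl⟩ : ∃ n, p = n + 1 := ⟨p - 1, (Nat.succ_pred_prime hpp.out).symm⟩
      rw [Nat.add_sub_cancel]
      ring
    rw [hexp, pow_add, pow_add, pow_add, mul_pow]
    ring
  · intro h
    rcases hπ.dvd_or_dvd h with h | h
    · rcases hπ.dvd_or_dvd h with h | h
      · exact hpw (prime_dvd_of_sub_one_dvd_intCast hp hζ hπ h)
      · obtain ⟨s, -, h⟩ := hπ.exists_mem_finset_dvd h
        exact hvπ s h
    · exact hm (prime_dvd_of_sub_one_dvd_intCast hp hζ hπ (hπ.dvd_of_dvd_pow h))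

/-! ### Descent to the integers -/

/-- Taking norms turns divisibility of `b` by `a` into divisibility of b^d by a^d in ℤ, with d the
degree of the field. -/
theorem NumberField.RingOfIntegers.intCast_dvd_intCast {K : Type*} [Field K] [NumberField K]
    {a b : ℤ} (h : (a : NumberField.RingOfIntegers K) ∣ b) : a ∣ b := by
  have h1 := map_dvd (Algebra.norm ℤ) h
  rw [← eq_intCast (algebraMap ℤ (NumberField.RingOfIntegers K)),
    ← eq_intCast (algebraMap ℤ (NumberField.RingOfIntegers K)) b, Algebra.norm_algebraMap,
    Algebra.norm_algebraMap] at h1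
  exact (Int.pow_dvd_pow_iff Module.finrank_pos.ne').mp h1

theorem theorem3p4 (p : ℕ) [Fact p.Prime] (hp : 3 ≤ p) :
    (∀ F : MonoidAlgebra ℤ (heisenbergGroup (ZMod p)),
      (p : ℤ) ∣ groupDet F → (p : ℤ) ^ (p ^ 2 + 3) ∣ groupDet F) ∧
    ∃ F : MonoidAlgebra ℤ (heisenbergGroup (ZMod p)),
      (p : ℤ) ^ (p ^ 2 + 3) ∣ groupDet F ∧ ¬ (p : ℤ) ^ (p ^ 2 + 4) ∣ groupDet F := by
  have hodd : Odd p := (Fact.out : p.Prime).odd_of_ne_two (by omega)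
  have : NeZero p := ⟨(Fact.out : p.Prime).ne_zero⟩
  have : IsCyclotomicExtension {p} ℚ (CyclotomicField p ℚ) :=
    CyclotomicField.isCyclotomicExtension p ℚ
  have hK := IsCyclotomicExtension.zeta_spec p ℚ (CyclotomicField p ℚ)
  have hζ := hK.toInteger_isPrimitiveRoot
  have hπ := hK.zeta_sub_one_prime'
  have hint : ∀ (n : ℕ) (b : ℤ),
      ((p : NumberField.RingOfIntegers (CyclotomicField p ℚ)) ^ n ∣ b) → (p : ℤ) ^ n ∣ b := by
    intro n b h
    refine NumberField.RingOfIntegers.intCast_dvd_intCast (K := CyclotomicField p ℚ) ?_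
    push_cast
    exact h
  refine ⟨fun F hF => hint _ _ (prime_pow_dvd_groupDet hodd hζ F
    (prime_dvd_sum_of_dvd_groupDet hodd hζ hπ F hF)), ?_⟩
  obtain ⟨F, v, hF, hv⟩ := exists_groupDet_eq_prime_pow_mul hodd hζ hπ
  refine ⟨F, hint _ _ (hF ▸ Dvd.intro _ rfl), fun h => hv ?_⟩
  have hp0 : (p : NumberField.RingOfIntegers (CyclotomicField p ℚ)) ≠ 0 :=
    Nat.cast_ne_zero.mpr (Fact.out : p.Prime).ne_zero
  have h1 := map_dvd (Int.castRingHom (NumberField.RingOfIntegers (CyclotomicField p ℚ))) h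
  rw [eq_intCast, eq_intCast, hF] at h1
  push_cast at h1
  -- One further factor `p` would divide `v`, although ζ - 1 divides `p` and not `v`.
  rw [show p ^ 2 + 4 = p ^ 2 + 3 + 1 by ring, pow_succ] at h1
  exact ((dvd_pow_self _ two_ne_zero).trans (sub_one_sq_dvd_prime hodd hζ)).trans
    ((mul_dvd_mul_iff_left (pow_ne_zero _ hp0)).mp h1)
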